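/- **Setting.** Let $T>0$, $p\in[2,\infty)$. A *problem set* $(V,H,M,\mathcal A)$ consists of real spaces $V$, $H$, a bounded linear $M:H\to H$, and operators $A(t):V\to V^*$, $t\in(0,T)$. Put $\mathcal H=L^2(0,T;H)$, $\mathcal V=L^p(0,T;V)$, $(\mathcal Mu)(t)=Mu(t)$, and let $\mathcal A:\mathcal V\to\mathcal V^*$ be the operator induced by $(\mathcal Au)(t)=A(t)u(t)$, i.e. $\langle\mathcal Au,v\rangle=\int_0^T\langle A(t)u(t),v(t)\rangle\,dt$. The problem set is *proper*, with $\mathcal A$ $k$-monotone for a function $k:\mathcal V\to[0,\infty)$, if $V$ is a separable reflexive Banach space that is continuously and densely embedded in the Hilbert space $H$; $M$ is monotone ($(Mu,u)_H\ge0$) and symmetric; $\mathcal A$ maps bounded sets to bounded sets; $\langle\mathcal Au-\mathcal Av,u-v\rangle\ge k(u-v)$ for all $u,v\in\mathcal V$; $\varepsilon\mapsto\langle\mathcal A(u+\varepsilon v),w\rangle$ is continuous on $[0,1]$ for all $u,v,w\in\mathcal V$; and $\langle\mathcal Au,u\rangle\to\infty$ as $\|u\|_{\mathcal V}\to\infty$.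 Then $\mathcal V\hookrightarrow\mathcal H\hookrightarrow\mathcal V^*$. Let $-d/dt$ be the generator on $\mathcal V^*$ of the translation semigroup $S(\tau)u(t)=u(t-\tau)$ for $t>\tau$, $S(\tau)u(t)=0$ for $t\le\tau$, and let $\mathcal W=\{u\in\mathcal V:\mathcal Mu\in D(d/dt)\}$. Let $(V,H,M,\mathcal A)$ and $(V_\ell,H_\ell,M_\ell,\mathcal A_\ell)$, $\ell=1,\dots,q$, be proper problem sets (with monotonicity functions $k$, $k_\ell$), let $f\in\mathcal V^*$, $f_\ell\in\mathcal V_\ell^*$, and let $E_\ell:H_\ell\to H$, $R_\ell:H\to H_\ell$ be bounded linear operators, with induced operators $\mathcal E_\ell$, $\mathcal R_\ell$ between $\mathcal H_\ell$ and $\mathcal H$. Define $\mathcal Fu=(\tfrac{d}{dt}\mathcal M+\mathcal A)u+f$ for $u\in\mathcal W$, and $$\mathcal F_\ell u=\mathcal E_\ell\bigl((\tfrac{d}{dt}\mathcal M_\ell+\mathcal A_\ell)\mathcal R_\ell u+f_\ell\bigr),\quad D(\mathcal F_\ell)=\{u\in\mathcal H:\mathcal R_\ell u\in\mathcal W_\ell,\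 (\tfrac{d}{dt}\mathcal M_\ell+\mathcal A_\ell)\mathcal R_\ell u+f_\ell\in\mathcal H_\ell\}.$$ **Assumptions.** 1. $R_\ell E_\ell=I$ on $H_\ell$, $(E_\ell u,v)_H=(u,R_\ell v)_{H_\ell}$ for $u\in H_\ell$, $v\in H$, and $M=\sum_{\ell=1}^qE_\ell M_\ell R_\ell$; moreover the subspaces $E_\ell H_\ell$ together span $H$, i.e. $H=\sum_{\ell=1}^qE_\ell H_\ell$. 2. $R_\ell$ is bounded from $V$ to $V_\ell$; and there is a constant $C_0$ such that, if $u\in H$ and $R_\ell u\in V_\ell$ for all $\ell$, then $u\in V$ and $\|u\|_V^p\le C_0\sum_{\ell=1}^q\|R_\ell u\|_{V_\ell}^p$. 3. Every $u\in\bigcap_{\ell=1}^qD(\mathcal F_\ell)$ satisfies $u\in\mathcal W$ and $\mathcal Fu=\sum_{\ell=1}^q\mathcal F_\ell u$ in $\mathcal H$. 4. $u\in\mathcal W$ is a solution of $\mathcal Fu=0$ in $\mathcal V^*$, and $u\in\bigcap_{\ell=1}^qD(\mathcal F_\ell)$. 5. There is a constant $c>0$ with $k_\ell(w)\ge c\|w\|_{\mathcal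 H_\ell}^2$ for all $w\in\mathcal V_\ell$ and $\ell=1,\dots,q$. **Theorem.** Let $C>0$ and $u^0\in\mathcal H$. For each $N\ge1$ let $s=C\sqrt N$ and let $u^1,\dots,u^N\in\mathcal H$ (depending on $N$) be the approximations given by the additive splitting scheme $$(sI+\mathcal F_\ell)u_\ell^{n+1}=su^n\quad(\ell=1,\dots,q),\qquad u^{n+1}=\frac1q\sum_{\ell=1}^qu_\ell^{n+1},\qquad n=0,\dots,N-1,$$ with $u_\ell^{n+1}\in D(\mathcal F_\ell)$. Then $\lim_{N\to\infty}\|u^N-u\|_{\mathcal H}=0$. -/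

import Mathlib

open MeasureTheory Set Filter Topology

noncomputable section

/-- Lebesgue measure on the time interval `(0, T)`. -/
abbrev timeMeasure (T : ℝ) : Measure ℝ := volume.restrict (Ioo 0 T)

instance fact_one_le_ofReal {p : ℝ} [hp : Fact (2 ≤ p)] : Fact (1 ≤ ENNReal.ofReal p) :=
  ⟨by
    have h := hp.out
    exact ENNReal.one_le_ofReal.2 (by linarith)⟩

theorem two_le_ofReal {p : ℝ} (hp : 2 ≤ p) : (2 : ENNReal) ≤ ENNReal.ofReal p := by
  have h := ENNReal.ofReal_le_ofReal hp
  simpa using h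

/-- The Bochner space `L²(0, T; H)`. -/
abbrev BochnerH (T : ℝ) (H : Type*) [NormedAddCommGroup H] : Type _ := Lp H 2 (timeMeasure T)

/-- The Bochner space `L^p(0, T; V)`. -/
abbrev BochnerV (T p : ℝ) (V : Type*) [NormedAddCommGroup V] : Type _ :=
  Lp V (ENNReal.ofReal p) (timeMeasure T)

/-- The dual space of `L^p(0, T; V)`. -/
abbrev BochnerVDual (T p : ℝ) [Fact (2 ≤ p)] (V : Type*) [NormedAddCommGroup V] [NormedSpace ℝ V] :
    Type _ :=
  StrongDual ℝ (BochnerV T p V)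

section Spaces

variable (T p : ℝ) [hp : Fact (2 ≤ p)]

/-- The inclusion `L^p(0, T; H) → L²(0, T; H)` for `p ≥ 2`. -/
def lpInclusion (H : Type*) [NormedAddCommGroup H] [NormedSpace ℝ H] :
    BochnerV T p H →L[ℝ] BochnerH T H :=
  LinearMap.mkContinuous
    { toFun := fun u => ((Lp.memLp u).mono_exponent (two_le_ofReal hp.out)).toLp u
      map_add' := fun u v => by
        rw [← MemLp.toLp_add, MemLp.toLp_eq_toLp_iff]
        exact Lp.coeFn_add u v
      map_smul' := fun c u => by
        rw [RingHom.id_apply, ← MemLp.toLp_const_smul, MemLp.toLp_eq_toLp_iff]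
        exact Lp.coeFn_smul c u }
    ((timeMeasure T univ ^ (1 / (2 : ENNReal).toReal - 1 / (ENNReal.ofReal p).toReal)).toReal)
    (fun u => by
      have h2 := two_le_ofReal hp.out
      have hexp : 0 ≤ 1 / (2 : ENNReal).toReal - 1 / (ENNReal.ofReal p).toReal := by
        have h := hp.out
        rw [ENNReal.toReal_ofReal (by linarith), ENNReal.toReal_ofNat, sub_nonneg]
        exact one_div_le_one_div_of_le (by norm_num) h
      have h := eLpNorm_le_eLpNorm_mul_rpow_measure_univ h2 (Lp.aestronglyMeasurable u)
      have hfin : eLpNorm u (ENNReal.ofReal p) (timeMeasure T) *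
          timeMeasure T univ ^ (1 / (2 : ENNReal).toReal - 1 / (ENNReal.ofReal p).toReal) ≠ ⊤ :=
        ENNReal.mul_ne_top (Lp.eLpNorm_ne_top u)
          (ENNReal.rpow_ne_top_of_nonneg hexp (measure_ne_top _ _))
      have h' := ENNReal.toReal_mono hfin h
      rw [ENNReal.toReal_mul, mul_comm] at h'
      rw [LinearMap.coe_mk, AddHom.coe_mk, Lp.norm_toLp, Lp.norm_def]
      exact h')

theorem indicator_congr_ae_restrict {V : Type*} [NormedAddCommGroup V] {u v : ℝ → V}
    (h : u =ᵐ[timeMeasure T] v) : (Ioo 0 T).indicator u =ᵐ[volume] (Ioo 0 T).indicator v := by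
  have h' := (ae_restrict_iff' measurableSet_Ioo).1 h
  filter_upwards [h'] with t ht
  by_cases hm : t ∈ Ioo 0 T
  · simp [hm, ht hm]
  · simp [hm]

theorem memLp_shift {V : Type*} [NormedAddCommGroup V] (τ : ℝ) {v : ℝ → V} {r : ENNReal}
    (hv : MemLp v r (timeMeasure T)) :
    MemLp (fun t => (Ioo 0 T).indicator v (t + τ)) r volume :=
  ((memLp_indicator_iff_restrict measurableSet_Ioo).2 hv).comp_measurePreserving
    (measurePreserving_add_right volume τ)

/-- The left translation on `L^p(0, T; V)`: the function is extended by zero from `(0, T)`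
to the real line, and `v` is sent to `t ↦ v (t + τ)`. -/
def leftShift (V : Type*) [NormedAddCommGroup V] [NormedSpace ℝ V] (τ : ℝ) :
    BochnerV T p V →L[ℝ] BochnerV T p V :=
  LinearMap.mkContinuous
    { toFun := fun v => ((memLp_shift T τ (Lp.memLp v)).restrict (Ioo 0 T)).toLp _
      map_add' := fun u v => by
        rw [← MemLp.toLp_add, MemLp.toLp_eq_toLp_iff]
        have h : (Ioo 0 T).indicator (u + v : BochnerV T p V) =ᵐ[volume]
            (Ioo 0 T).indicator (⇑u + ⇑v) :=
          indicator_congr_ae_restrict T (Lp.coeFn_add u v)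
        have h' := (measurePreserving_add_right volume τ).quasiMeasurePreserving.ae_eq_comp h
        filter_upwards [ae_restrict_of_ae h'] with t ht
        exact ht.trans (congrFun (indicator_add' (Ioo 0 T) (⇑u) (⇑v)) (t + τ))
      map_smul' := fun c u => by
        rw [RingHom.id_apply, ← MemLp.toLp_const_smul, MemLp.toLp_eq_toLp_iff]
        have h : (Ioo 0 T).indicator (c • u : BochnerV T p V) =ᵐ[volume]
            (Ioo 0 T).indicator (c • ⇑u) :=
          indicator_congr_ae_restrict T (Lp.coeFn_smul c u)
        have h' := (measurePreserving_add_right volume τ).quasiMeasurePreserving.ae_eq_comp h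
        filter_upwards [ae_restrict_of_ae h'] with t ht
        have h2 := indicator_const_smul_apply (Ioo 0 T) c (⇑u) (t + τ)
        exact ht.trans h2 }
    1
    (fun v => by
      rw [one_mul]
      rw [LinearMap.coe_mk, AddHom.coe_mk, Lp.norm_toLp, Lp.norm_def]
      refine ENNReal.toReal_mono (Lp.eLpNorm_ne_top v) ?_
      refine (eLpNorm_mono_measure _ Measure.restrict_le_self).trans ?_
      have hm : AEStronglyMeasurable ((Ioo 0 T).indicator v) volume :=
        ((memLp_indicator_iff_restrict measurableSet_Ioo).2 (Lp.memLp v)).1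
      have h := eLpNorm_comp_measurePreserving (p := ENNReal.ofReal p) hm
        (measurePreserving_add_right volume τ)
      exact (h.trans (eLpNorm_indicator_eq_eLpNorm_restrict measurableSet_Ioo)).le)

/-- The right translation semigroup `S(τ)` on the dual of `L^p(0, T; V)`. For `g` given by a
function with values in `V*` one has
`⟨S(τ) g, v⟩ = ∫_τ^T ⟨g(t - τ), v(t)⟩ dt = ∫_0^{T-τ} ⟨g(t), v(t + τ)⟩ dt`,
so `S(τ)` is the adjoint of the left translation. -/
def rightShift (V : Type*) [NormedAddCommGroup V] [NormedSpace ℝ V] (τ : ℝ)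
    (g : BochnerVDual T p V) : BochnerVDual T p V :=
  g.comp (leftShift T p V τ)

end Spaces

/-- `g` lies in the domain of `d/dt` and `d/dt g = z`, where `-d/dt` is the generator of the
translation semigroup `S` on the dual of `L^p(0, T; V)`. -/
def HasTimeDeriv {T p : ℝ} [Fact (2 ≤ p)] {V : Type*} [NormedAddCommGroup V] [NormedSpace ℝ V]
    (g z : BochnerVDual T p V) : Prop :=
  Tendsto (fun τ : ℝ => τ⁻¹ • (g - rightShift T p V τ g)) (𝓝[>] 0) (𝓝 z)

/-- The data of the nonlinear Cauchy problem `(d/dt 𝓜 + 𝓐) u + f = 0`: an embedding of `V`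
into `H`, a bounded linear `M : H → H`, a family `A t : V → V*`, the operator `𝓐` from
`𝓥 = L^p(0, T; V)` to `𝓥*` induced by this family, and `f` in `𝓥*`. -/
structure CauchyProblem (T p : ℝ) [Fact (2 ≤ p)] (V H : Type*)
    [NormedAddCommGroup V] [NormedSpace ℝ V]
    [NormedAddCommGroup H] [InnerProductSpace ℝ H] where
  /-- the embedding of `V` into `H` -/
  emb : V →L[ℝ] H
  /-- the operator `M` on `H` -/
  M : H →L[ℝ] H
  /-- the family of operators `A(t)` from `V` to `V*` -/
  A : ℝ → V → StrongDual ℝ V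
  /-- the induced operator from `𝓥` to `𝓥*` -/
  opA : BochnerV T p V → BochnerVDual T p V
  opA_integrable : ∀ u v : BochnerV T p V, Integrable (fun t => A t (u t) (v t)) (timeMeasure T)
  opA_apply : ∀ u v : BochnerV T p V, opA u v = ∫ t, A t (u t) (v t) ∂(timeMeasure T)
  /-- the source term -/
  f : BochnerVDual T p V

namespace CauchyProblem

variable {T p : ℝ} [Fact (2 ≤ p)] {V H : Type*}
  [NormedAddCommGroup V] [NormedSpace ℝ V]
  [NormedAddCommGroup H] [InnerProductSpace ℝ H]
  (P : CauchyProblem T p V H)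

/-- The embedding of `L^p(0, T; V)` into `L²(0, T; H)`. -/
def toH : BochnerV T p V →L[ℝ] BochnerH T H :=
  (lpInclusion T p H).comp (P.emb.compLpL (ENNReal.ofReal p) (timeMeasure T))

/-- The embedding of `L²(0, T; H)` into the dual of `L^p(0, T; V)`, `u ↦ (u, ·)`. -/
def toDual (u : BochnerH T H) : BochnerVDual T p V :=
  (innerSL ℝ u).comp P.toH

/-- The operator on `L²(0, T; H)` induced by `M`. -/
def opM : BochnerH T H →L[ℝ] BochnerH T H := P.M.compLpL 2 (timeMeasure T)

/-- `w ∈ 𝓦` (that is, `w ∈ 𝓥` and `𝓜 w` is in the domain of `d/dt`) and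
`(d/dt 𝓜 + 𝓐) w + f = g` in `𝓥*`. -/
def IsSol (w : BochnerV T p V) (g : BochnerVDual T p V) : Prop :=
  ∃ z : BochnerVDual T p V, HasTimeDeriv (P.toDual (P.opM (P.toH w))) z ∧ z + P.opA w + P.f = g

/-- The graph of the restriction of `𝓕 = (d/dt 𝓜 + 𝓐) + f` to an operator on `L²(0, T; H)`:
`u ∈ 𝓦`, `𝓕 u ∈ L²(0, T; H)` and `𝓕 u = g`. -/
def Graph (u g : BochnerH T H) : Prop :=
  ∃ w : BochnerV T p V, P.toH w = u ∧ P.IsSol w (P.toDual g)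

/-- The problem set `(V, H, M, 𝓐)` is proper, with `𝓐` being `k`-monotone. -/
structure IsProper (k : BochnerV T p V → ℝ) : Prop where
  complete_V : CompleteSpace V
  separable_V : TopologicalSpace.SeparableSpace V
  reflexive_V : Function.Surjective (NormedSpace.inclusionInDoubleDual ℝ V)
  complete_H : CompleteSpace H
  emb_injective : Function.Injective P.emb
  emb_dense : DenseRange P.emb
  M_monotone : ∀ u : H, 0 ≤ inner ℝ (P.M u) u
  M_symmetric : ∀ u v : H, inner ℝ (P.M u) v = inner ℝ (P.M v) u
  bounded : ∀ B : Set (BochnerV T p V), Bornology.IsBounded B → Bornology.IsBounded (P.opA '' B)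
  k_nonneg : ∀ u, 0 ≤ k u
  k_monotone : ∀ u v, k (u - v) ≤ (P.opA u - P.opA v) (u - v)
  hemicontinuous : ∀ u v w : BochnerV T p V,
    ContinuousOn (fun ε : ℝ => P.opA (u + ε • v) w) (Icc 0 1)
  coercive : Tendsto (fun u => P.opA u u) (Bornology.cobounded (BochnerV T p V)) atTop

end CauchyProblem

section Decomposition

variable {T p : ℝ} [Fact (2 ≤ p)] {q : ℕ} {V H : Type*}
  [NormedAddCommGroup V] [NormedSpace ℝ V]
  [NormedAddCommGroup H] [InnerProductSpace ℝ H]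
  {Vl Hl : Fin q → Type*}
  [∀ l, NormedAddCommGroup (Vl l)] [∀ l, NormedSpace ℝ (Vl l)]
  [∀ l, NormedAddCommGroup (Hl l)] [∀ l, InnerProductSpace ℝ (Hl l)]

/-- All problem sets are proper, `R l` is a left inverse and the adjoint of `E l`, and
`M = ∑ E l ∘ M l ∘ R l`. -/
structure IsDecomposition (P : CauchyProblem T p V H)
    (Pl : ∀ l, CauchyProblem T p (Vl l) (Hl l))
    (E : ∀ l, Hl l →L[ℝ] H) (R : ∀ l, H →L[ℝ] Hl l)
    (k : BochnerV T p V → ℝ) (kl : ∀ l, BochnerV T p (Vl l) → ℝ) : Prop where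
  proper : P.IsProper k
  proper_sub : ∀ l, (Pl l).IsProper (kl l)
  left_inverse : ∀ l (u : Hl l), R l (E l u) = u
  adjoint : ∀ l (u : Hl l) (v : H), inner ℝ (E l u) v = inner ℝ u (R l v)
  sum_M : ∀ u : H, P.M u = ∑ l, E l ((Pl l).M (R l u))

/-- The compatibility of `V` with the spaces `V l`: `R l` is bounded from `V` to `V l`, and
`u ∈ H` with `R l u ∈ V l` for all `l` is in `V` with `‖u‖^p ≤ C ∑ ‖R l u‖^p`. -/
structure IsSpaceCompatible (P : CauchyProblem T p V H)
    (Pl : ∀ l, CauchyProblem T p (Vl l) (Hl l)) (R : ∀ l, H →L[ℝ] Hl l) : Prop where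
  restrict : ∀ l, ∃ R' : V →L[ℝ] Vl l, ∀ v : V, (Pl l).emb (R' v) = R l (P.emb v)
  glue : ∃ C : ℝ, ∀ (u : H) (w : ∀ l, Vl l), (∀ l, (Pl l).emb (w l) = R l u) →
    ∃ v : V, P.emb v = u ∧ ‖v‖ ^ p ≤ C * ∑ l, ‖w l‖ ^ p

/-- The graph of the operator `𝓕 l` on `L²(0, T; H)`, namely
`𝓕 l u = 𝓔 l ((d/dt 𝓜 l + 𝓐 l) (𝓡 l u) + f l)`, with domain all `u ∈ L²(0, T; H)` for which
`𝓡 l u ∈ 𝓦 l` and `(d/dt 𝓜 l + 𝓐 l) (𝓡 l u) + f l ∈ L²(0, T; H l)`. -/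
def SubGraph (Pl : ∀ l, CauchyProblem T p (Vl l) (Hl l))
    (E : ∀ l, Hl l →L[ℝ] H) (R : ∀ l, H →L[ℝ] Hl l) (l : Fin q) (u g : BochnerH T H) : Prop :=
  ∃ h : BochnerH T (Hl l), (Pl l).Graph ((R l).compLpL 2 (timeMeasure T) u) h ∧
    g = (E l).compLpL 2 (timeMeasure T) h

/-- `𝓕 u = ∑ 𝓕 l u` in `L²(0, T; H)` for all `u` in the intersection of the domains of the
operators `𝓕 l`. -/
def IsOperatorSplitting (P : CauchyProblem T p V H)
    (Pl : ∀ l, CauchyProblem T p (Vl l) (Hl l))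
    (E : ∀ l, Hl l →L[ℝ] H) (R : ∀ l, H →L[ℝ] Hl l) : Prop :=
  ∀ (u : BochnerH T H) (g : Fin q → BochnerH T H), (∀ l, SubGraph Pl E R l u (g l)) →
    P.Graph u (∑ l, g l)

/-- `u 0, …, u N` are the first iterates of the additive splitting scheme with parameter `s`:
`(s I + 𝓕 l) u_l^{n+1} = s u^n` for all `l`, and `u^{n+1} = (1 / q) ∑ u_l^{n+1}`. -/
def IsAdditiveSplitting (Pl : ∀ l, CauchyProblem T p (Vl l) (Hl l))
    (E : ∀ l, Hl l →L[ℝ] H) (R : ∀ l, H →L[ℝ] Hl l) (s : ℝ) (N : ℕ)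
    (u : ℕ → BochnerH T H) : Prop :=
  ∀ n < N, ∃ ul : Fin q → BochnerH T H,
    (∀ l, ∃ g : BochnerH T H, SubGraph Pl E R l (ul l) g ∧ s • ul l + g = s • u n) ∧
    u (n + 1) = (1 / (q : ℝ)) • ∑ l, ul l

end Decomposition

end

/-!
The function `‖Uⁿ - u‖²` obeys a scalar recursion whose solution tends to zero.

Write `e = Uⁿ - u`, let `g l = 𝓕 l u`, and let `e' l` be the error of the `l`-th resolvent
problem. Then `s (e' l) + (𝓕 l (u + e' l) - g l) = s e - g l`. Two facts make this useful.

* *Monotonicity* (`SubGraph.monotone`). Testing with `e' l` gives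
  `(𝓕 l (u + e' l) - g l, e' l) ≥ c ‖𝓡 l (e' l)‖²`. For the operators `𝓐 l` this is an assumption.
  For `d/dt 𝓜` it suffices that the difference quotients `τ⁻¹ (𝓜 w - S(τ) 𝓜 w)` are nonnegative
  when tested with `w`; this follows from the Cauchy-Schwarz inequality for the positive
  semidefinite form of `M`, since the left translation does not increase that form
  (`CauchyProblem.inner_opM_leftShift_le`).
* *Consistency* (`CauchyProblem.IsSol.eq_zero_of_graph`). As `𝓕 u = 0`, as `V` is dense in `H` and
  as time derivatives are unique, `∑ g l = 0` in `L²(0, T; H)`. So `∑ (g l, e' l)` equals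
  `∑ (g l, e' l - e)`, and the part `‖e' l - e‖²` gained in the energy estimate absorbs it at the
  price of `‖g l‖² / s`.

The `E l` together map onto `H`, hence by the open mapping theorem `κ ‖v‖² ≤ ∑ ‖R l v‖²` for some
`κ > 0` (`exists_pos_mul_norm_sq_le_sum`), which turns the bounds for the restrictions into
contraction on `H`. Together (`splitting_step_estimate`)
`‖Uⁿ⁺¹ - u‖² ≤ (1 - δ / s) ‖Uⁿ - u‖² + K / s²`, and after `N` steps with `s = C √N` the error is
bounded by `exp (-δ √N / C) ‖u₀ - u‖² + K / (δ C √N)`.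
-/

/-! ### Pointwise operators on `L²` -/

section LinearOperators

variable {α X Y : Type*} [MeasurableSpace α] {μ : Measure α}
  [NormedAddCommGroup X] [InnerProductSpace ℝ X] [NormedAddCommGroup Y] [InnerProductSpace ℝ Y]

theorem inner_compLpL_of_adjoint {E : Y →L[ℝ] X} {R : X →L[ℝ] Y}
    (h : ∀ u v, inner ℝ (E u) v = inner ℝ u (R v)) (u : Lp Y 2 μ) (v : Lp X 2 μ) :
    inner ℝ (E.compLpL 2 μ u) v = inner ℝ u (R.compLpL 2 μ v) := by
  rw [L2.inner_def, L2.inner_def]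
  refine integral_congr_ae ?_
  filter_upwards [E.coeFn_compLpL (p := 2) u, R.coeFn_compLpL (p := 2) v] with t h1 h2
  rw [h1, h2, h]

theorem inner_compLpL_self_nonneg {M : X →L[ℝ] X} (h : ∀ u, 0 ≤ inner ℝ (M u) u) (u : Lp X 2 μ) :
    0 ≤ inner ℝ (M.compLpL 2 μ u) u := by
  rw [L2.inner_def]
  refine integral_nonneg_of_ae ?_
  filter_upwards [M.coeFn_compLpL (p := 2) u] with t h1
  rw [h1]
  exact h _

theorem two_mul_inner_le_of_nonneg {M : X →L[ℝ] X} (hnonneg : ∀ u, 0 ≤ inner ℝ (M u) u)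
    (hsymm : ∀ u v, inner ℝ (M u) v = inner ℝ (M v) u) (u v : X) :
    2 * inner ℝ (M u) v ≤ inner ℝ (M u) u + inner ℝ (M v) v := by
  have h := hnonneg (u - v)
  rw [map_sub, inner_sub_left, inner_sub_right, inner_sub_right, hsymm v u] at h
  linarith

theorem norm_sq_eq_integral (v : Lp X 2 μ) : ‖v‖ ^ 2 = ∫ t, ‖v t‖ ^ 2 ∂μ := by
  rw [← real_inner_self_eq_norm_sq, L2.inner_def]
  simp only [real_inner_self_eq_norm_sq]

theorem integrable_norm_sq (v : Lp X 2 μ) : Integrable (fun t => ‖v t‖ ^ 2) μ := by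
  simpa only [real_inner_self_eq_norm_sq] using L2.integrable_inner (𝕜 := ℝ) v v

end LinearOperators

/-! ### Coercivity from the spanning assumption -/

section Coercivity

variable {ι X : Type*} [Fintype ι] {Y : ι → Type*}
  [NormedAddCommGroup X] [InnerProductSpace ℝ X]
  [∀ l, NormedAddCommGroup (Y l)] [∀ l, InnerProductSpace ℝ (Y l)]

/-- If the ranges of the operators `E l` span `X`, then their adjoints `R l` are jointly bounded
below: the open mapping theorem gives `v = ∑ E l (w l)` with `‖w l‖ ≤ K ‖v‖`, and then
`‖v‖² = ∑ (w l, R l v)`. -/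
theorem exists_pos_mul_norm_sq_le_sum [CompleteSpace X] [∀ l, CompleteSpace (Y l)]
    {E : ∀ l, Y l →L[ℝ] X} {R : ∀ l, X →L[ℝ] Y l}
    (hadj : ∀ l (u : Y l) (v : X), inner ℝ (E l u) v = inner ℝ u (R l v))
    (hspan : ∀ v : X, ∃ w : ∀ l, Y l, v = ∑ l, E l (w l)) :
    ∃ κ : ℝ, 0 < κ ∧ ∀ v : X, κ * ‖v‖ ^ 2 ≤ ∑ l, ‖R l v‖ ^ 2 := by
  let S : (∀ l, Y l) →L[ℝ] X := ∑ l, (E l).comp (ContinuousLinearMap.proj l)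
  have hS : Function.Surjective S := fun v => by
    obtain ⟨w, hw⟩ := hspan v
    exact ⟨w, by simp [S, hw]⟩
  obtain ⟨K, hK, hb⟩ := S.exists_preimage_norm_le hS
  -- `K ^ 2 * card ι` is the natural constant; adding one keeps it positive for empty `ι`.
  refine ⟨(K ^ 2 * (Fintype.card ι + 1))⁻¹, by positivity, fun v => ?_⟩
  obtain ⟨w, hw, hwK⟩ := hb v
  have h1 : ‖v‖ ^ 2 ≤ K * ‖v‖ * ∑ l, ‖R l v‖ := by
    calc ‖v‖ ^ 2 = inner ℝ (S w) v := by rw [hw, real_inner_self_eq_norm_sq]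
      _ = ∑ l, inner ℝ (w l) (R l v) := by simp [S, sum_inner, hadj]
      _ ≤ ∑ l, K * ‖v‖ * ‖R l v‖ := by
          refine Finset.sum_le_sum fun l _ => (real_inner_le_norm _ _).trans ?_
          gcongr
          exact (norm_le_pi_norm w l).trans hwK
      _ = _ := by rw [Finset.mul_sum]
  have h2 : ‖v‖ ≤ K * ∑ l, ‖R l v‖ := by
    rcases eq_or_lt_of_le (norm_nonneg v) with h | h
    · rw [← h]; positivity
    · nlinarith
  have h3 : (∑ l, ‖R l v‖) ^ 2 ≤ Fintype.card ι * ∑ l, ‖R l v‖ ^ 2 :=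
    sq_sum_le_card_mul_sum_sq
  rw [inv_mul_le_iff₀ (by positivity)]
  have h0 : 0 ≤ ∑ l, ‖R l v‖ ^ 2 := by positivity
  calc ‖v‖ ^ 2 ≤ (K * ∑ l, ‖R l v‖) ^ 2 := by gcongr
    _ = K ^ 2 * (∑ l, ‖R l v‖) ^ 2 := by ring
    _ ≤ K ^ 2 * (Fintype.card ι * ∑ l, ‖R l v‖ ^ 2) := by gcongr
    _ ≤ _ := by nlinarith [sq_nonneg K, mul_nonneg (sq_nonneg K) h0]

theorem mul_norm_sq_le_sum_compLpL {α : Type*} [MeasurableSpace α] {μ : Measure α}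
    {R : ∀ l, X →L[ℝ] Y l} {κ : ℝ} (h : ∀ v : X, κ * ‖v‖ ^ 2 ≤ ∑ l, ‖R l v‖ ^ 2) (v : Lp X 2 μ) :
    κ * ‖v‖ ^ 2 ≤ ∑ l, ‖(R l).compLpL 2 μ v‖ ^ 2 := by
  simp only [norm_sq_eq_integral]
  rw [← integral_const_mul, ← integral_finsetSum _ fun l _ => integrable_norm_sq _]
  refine integral_mono_ae ((integrable_norm_sq v).const_mul κ)
    (integrable_finsetSum _ fun l _ => integrable_norm_sq _) ?_
  have hR : ∀ᵐ t ∂μ, ∀ l, (R l).compLpL 2 μ v t = R l (v t) :=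
    ae_all_iff.2 fun l => (R l).coeFn_compLpL v
  filter_upwards [hR] with t ht
  simpa only [ht] using h (v t)

end Coercivity

/-! ### The energy recursion -/

section Recursion

variable {q : ℕ} {X : Type*} {Y : Fin q → Type*}
  [NormedAddCommGroup X] [InnerProductSpace ℝ X]
  [∀ l, NormedAddCommGroup (Y l)] [∀ l, InnerProductSpace ℝ (Y l)]

/-- Energy estimate for a single resolvent equation. The error `e'` is compared with `e` through
`2 (e, e') = ‖e‖² + ‖e'‖² - ‖e' - e‖²`; half of the gained `s ‖e' - e‖²` bounds `2 (g, e' - e)`, and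
the other half, for large `s`, allows `‖R e'‖` to be replaced by `‖R e‖`. -/
theorem resolvent_energy_estimate {Z : Type*} [NormedAddCommGroup Z] [InnerProductSpace ℝ Z]
    {R : X →L[ℝ] Z} {c s : ℝ} (hc : 0 < c) (hs : 0 < s) (hsR : 4 * c * ‖R‖ ^ 2 ≤ s)
    {e e' d g : X} (heq : s • e' + d = s • e - g) (hmono : c * ‖R e'‖ ^ 2 ≤ inner ℝ d e') :
    s * ‖e'‖ ^ 2 + c * ‖R e‖ ^ 2 ≤ s * ‖e‖ ^ 2 + 2 * ‖g‖ ^ 2 / s - 2 * inner ℝ g e := by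
  have h1 : s * ‖e'‖ ^ 2 + inner ℝ d e' = s * inner ℝ e e' - inner ℝ g e' := by
    have h := congrArg (fun x => inner ℝ x e') heq
    simpa only [inner_add_left, inner_sub_left, real_inner_smul_left,
      real_inner_self_eq_norm_sq] using h
  have h2 : ‖e' - e‖ ^ 2 = ‖e'‖ ^ 2 - 2 * inner ℝ e e' + ‖e‖ ^ 2 := by
    rw [norm_sub_sq_real, real_inner_comm]
  have h3 : inner ℝ g e' = inner ℝ g e + inner ℝ g (e' - e) := by
    rw [inner_sub_right]; ring
  have h4 : -(‖g‖ * ‖e' - e‖) ≤ inner ℝ g (e' - e) :=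
    (abs_le.1 (abs_real_inner_le_norm _ _)).1
  have h5 : 2 * (‖g‖ * ‖e' - e‖) ≤ 2 * ‖g‖ ^ 2 / s + s / 2 * ‖e' - e‖ ^ 2 := by
    have h : 2 * ‖g‖ ^ 2 / s + s / 2 * ‖e' - e‖ ^ 2 - 2 * (‖g‖ * ‖e' - e‖)
        = (2 * ‖g‖ - s * ‖e' - e‖) ^ 2 / (2 * s) := by
      field_simp; ring
    have : 0 ≤ (2 * ‖g‖ - s * ‖e' - e‖) ^ 2 / (2 * s) := by positivity
    linarith
  have h6 : ‖R e‖ ^ 2 ≤ 2 * ‖R e'‖ ^ 2 + 2 * (‖R‖ ^ 2 * ‖e' - e‖ ^ 2) := by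
    have ha : ‖R e‖ ≤ ‖R e'‖ + ‖R‖ * ‖e' - e‖ := by
      calc ‖R e‖ = ‖R e' - R (e' - e)‖ := by rw [map_sub]; congr 1; abel
        _ ≤ ‖R e'‖ + ‖R (e' - e)‖ := norm_sub_le _ _
        _ ≤ _ := by gcongr; exact R.le_opNorm _
    calc ‖R e‖ ^ 2 ≤ (‖R e'‖ + ‖R‖ * ‖e' - e‖) ^ 2 := by gcongr
      _ ≤ _ := by nlinarith [sq_nonneg (‖R e'‖ - ‖R‖ * ‖e' - e‖)]
  have h7 : 4 * c * ‖R‖ ^ 2 * ‖e' - e‖ ^ 2 ≤ s * ‖e' - e‖ ^ 2 := by gcongr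
  have h8 := mul_le_mul_of_nonneg_left h6 hc.le
  have h9 := congrArg (fun x => s * x) h2
  nlinarith

/-- One step of the additive splitting scheme. The first-order terms `(g l, e)` of the resolvent
estimates cancel in the sum, so that the consistency error is of order `s⁻²`. -/
theorem splitting_step_estimate (hq : 0 < q) {R : ∀ l, X →L[ℝ] Y l} {c s κ : ℝ} (hc : 0 < c)
    (hs : 0 < s) (hsR : ∀ l, 4 * c * ‖R l‖ ^ 2 ≤ s)
    (hκ : ∀ v : X, κ * ‖v‖ ^ 2 ≤ ∑ l, ‖R l v‖ ^ 2)
    {e : X} {e' d g : Fin q → X} (hg : ∑ l, g l = 0)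
    (heq : ∀ l, s • e' l + d l = s • e - g l)
    (hmono : ∀ l, c * ‖R l (e' l)‖ ^ 2 ≤ inner ℝ (d l) (e' l)) :
    ‖(1 / (q : ℝ)) • ∑ l, e' l‖ ^ 2 ≤
      (1 - c * κ / q / s) * ‖e‖ ^ 2 + 2 * (∑ l, ‖g l‖ ^ 2) / q / s ^ 2 := by
  have hq' : (0 : ℝ) < q := by exact_mod_cast hq
  have h1 := Finset.sum_le_sum fun l (_ : l ∈ Finset.univ) =>
    resolvent_energy_estimate hc hs (hsR l) (heq l) (hmono l)
  have h0 : ∑ l, inner ℝ (g l) e = 0 := by rw [← sum_inner, hg, inner_zero_left]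
  rw [Finset.sum_add_distrib, Finset.sum_sub_distrib, Finset.sum_add_distrib, ← Finset.mul_sum,
    ← Finset.mul_sum, ← Finset.mul_sum, ← Finset.sum_div, ← Finset.mul_sum, ← Finset.mul_sum, h0,
    mul_zero, Finset.sum_const, Finset.card_univ, Fintype.card_fin, nsmul_eq_mul, sub_zero] at h1
  have h2 := mul_le_mul_of_nonneg_left (hκ e) hc.le
  have h3 : ‖∑ l, e' l‖ ^ 2 ≤ q * ∑ l, ‖e' l‖ ^ 2 := by
    calc ‖∑ l, e' l‖ ^ 2 ≤ (∑ l, ‖e' l‖) ^ 2 := by gcongr; exact norm_sum_le _ _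
      _ ≤ _ := by simpa using sq_sum_le_card_mul_sum_sq (s := Finset.univ) (f := fun l => ‖e' l‖)
  have h4 : ‖(1 / (q : ℝ)) • ∑ l, e' l‖ ^ 2 ≤ (∑ l, ‖e' l‖ ^ 2) / q := by
    rw [norm_smul, mul_pow, Real.norm_of_nonneg (by positivity), one_div, inv_pow,
      inv_mul_le_iff₀ (by positivity)]
    calc _ ≤ _ := h3
      _ = _ := by field_simp
  refine h4.trans ?_
  rw [div_le_iff₀ hq']
  have h5 : ((1 - c * κ / q / s) * ‖e‖ ^ 2 + 2 * (∑ l, ‖g l‖ ^ 2) / q / s ^ 2) * q =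
      (s * (q * ‖e‖ ^ 2) - c * (κ * ‖e‖ ^ 2) + 2 * (∑ l, ‖g l‖ ^ 2) / s) / s := by
    field_simp
  rw [h5, le_div_iff₀ hs]
  linarith

/-- A discrete Gronwall inequality; `K / δ / s` is the fixed point of the recursion. -/
theorem le_pow_mul_add_of_recursion {a : ℕ → ℝ} {δ K s : ℝ} {N : ℕ} (hδ : 0 < δ) (hδs : δ ≤ s)
    (hK : 0 ≤ K) (ha : ∀ n < N, a (n + 1) ≤ (1 - δ / s) * a n + K / s ^ 2) :
    ∀ n ≤ N, a n ≤ (1 - δ / s) ^ n * a 0 + K / δ / s := by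
  have hs : 0 < s := hδ.trans_le hδs
  have h1 : 0 ≤ 1 - δ / s := sub_nonneg.2 ((div_le_one hs).2 hδs)
  intro n
  induction n with
  | zero =>
    intro _
    rw [pow_zero, one_mul]
    exact le_add_of_nonneg_right (by positivity)
  | succ n ih =>
    intro hn
    have hfix : (1 - δ / s) * (K / δ / s) + K / s ^ 2 = K / δ / s := by
      field_simp
      ring
    calc a (n + 1) ≤ (1 - δ / s) * a n + K / s ^ 2 := ha n hn
      _ ≤ (1 - δ / s) * ((1 - δ / s) ^ n * a 0 + K / δ / s) + K / s ^ 2 := by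
          gcongr; exact ih (by omega)
      _ = _ := by rw [mul_add, add_assoc, hfix, pow_succ', mul_assoc]

theorem tendsto_recursion_bound {δ C : ℝ} (hδ : 0 < δ) (hC : 0 < C) (a K : ℝ) :
    Tendsto (fun N : ℕ => (1 - δ / (C * √N)) ^ N * a + K / (C * √N)) atTop (𝓝 0) := by
  have hs : Tendsto (fun N : ℕ => √(N : ℝ)) atTop atTop :=
    Real.tendsto_sqrt_atTop.comp tendsto_natCast_atTop_atTop
  have hsC : Tendsto (fun N : ℕ => C * √(N : ℝ)) atTop atTop := hs.const_mul_atTop hC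
  have hexp : Tendsto (fun N : ℕ => Real.exp (-(δ / C * √(N : ℝ)))) atTop (𝓝 0) :=
    Real.tendsto_exp_neg_atTop_nhds_zero.comp (hs.const_mul_atTop (by positivity))
  have hpow : Tendsto (fun N : ℕ => (1 - δ / (C * √N)) ^ N) atTop (𝓝 0) := by
    refine tendsto_of_tendsto_of_tendsto_of_le_of_le' tendsto_const_nhds hexp ?_ ?_
    · filter_upwards [hsC.eventually_ge_atTop δ, hsC.eventually_gt_atTop 0] with N h1 h2
      exact pow_nonneg (sub_nonneg.2 ((div_le_one h2).2 h1)) _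
    · filter_upwards [hsC.eventually_ge_atTop δ, hsC.eventually_gt_atTop 0,
        hs.eventually_gt_atTop 0] with N h1 h2 h3
      calc (1 - δ / (C * √N)) ^ N ≤ Real.exp (-(δ / (C * √N))) ^ N := by
            gcongr
            · exact sub_nonneg.2 ((div_le_one h2).2 h1)
            · exact Real.one_sub_le_exp_neg _
        _ = Real.exp (-(δ / C * √N)) := by
            rw [← Real.exp_nat_mul]
            congr 1
            have h : (N : ℝ) = √N * √N := (Real.mul_self_sqrt (Nat.cast_nonneg N)).symm
            rw [show (N : ℝ) * -(δ / (C * √N)) = (√N * √N) * -(δ / (C * √N)) by rw [← h]]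
            field_simp
  simpa using (hpow.mul_const a).add (tendsto_const_nhds.div_atTop hsC)

end Recursion

/-! ### Monotonicity of the time derivative -/

section TimeDerivative

variable {T p : ℝ} [Fact (2 ≤ p)] {V H : Type*}
  [NormedAddCommGroup V] [NormedSpace ℝ V]
  [NormedAddCommGroup H] [InnerProductSpace ℝ H]

theorem HasTimeDeriv.sub {g g' z z' : BochnerVDual T p V} (h : HasTimeDeriv g z)
    (h' : HasTimeDeriv g' z') : HasTimeDeriv (g - g') (z - z') := by
  refine (Tendsto.sub h h').congr fun τ => ?_
  ext v
  simp only [rightShift, ContinuousLinearMap.sub_comp, smul_apply,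
    sub_apply, smul_eq_mul]
  ring

theorem HasTimeDeriv.unique {g z z' : BochnerVDual T p V} (h : HasTimeDeriv g z)
    (h' : HasTimeDeriv g z') : z = z' :=
  tendsto_nhds_unique h h'

theorem coeFn_leftShift (τ : ℝ) (w : BochnerV T p V) :
    leftShift T p V τ w =ᵐ[timeMeasure T] fun t => (Ioo 0 T).indicator w (t + τ) :=
  MemLp.coeFn_toLp ((memLp_shift T τ (Lp.memLp w)).restrict (Ioo 0 T))

namespace CauchyProblem

variable (P : CauchyProblem T p V H)

theorem coeFn_toH (w : BochnerV T p V) :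
    P.toH w =ᵐ[timeMeasure T] fun t => P.emb (w t) := by
  have h : P.toH w =ᵐ[timeMeasure T] P.emb.compLpL (ENNReal.ofReal p) (timeMeasure T) w :=
    MemLp.coeFn_toLp ((Lp.memLp _).mono_exponent (two_le_ofReal Fact.out))
  exact h.trans (P.emb.coeFn_compLpL w)

theorem toDual_apply (g : BochnerH T H) (w : BochnerV T p V) :
    P.toDual g w = inner ℝ g (P.toH w) := rfl

theorem toDual_sub (g h : BochnerH T H) : P.toDual (g - h) = P.toDual g - P.toDual h := by
  ext w
  simp [toDual_apply, inner_sub_left]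

theorem toH_injective (hP : Function.Injective P.emb) : Function.Injective P.toH := by
  intro u v huv
  refine Lp.ext ?_
  filter_upwards [P.coeFn_toH u, P.coeFn_toH v] with t h1 h2
  rw [huv, h2] at h1
  exact (hP h1).symm

/-- Density of `V` in `H` makes the embedding of `L²(0, T; H)` into the dual of `L^p(0, T; V)`
injective: testing with the functions that equal `x ∈ V` on a measurable set and vanish elsewhere
shows that all integrals of `g` over measurable sets vanish. -/
theorem toDual_eq_zero (hP : DenseRange P.emb) [CompleteSpace H] {g : BochnerH T H}
    (hg : P.toDual g = 0) : g = 0 := by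
  refine Lp.eq_zero_iff_ae_eq_zero.2 ?_
  refine Lp.ae_eq_zero_of_forall_setIntegral_eq_zero g two_ne_zero ENNReal.ofNat_ne_top
    (fun s _ hμs => integrableOn_Lp_of_measure_ne_top g one_le_two hμs.ne) fun s hs hμs => ?_
  refine hP.eq_zero_of_inner_right ℝ fun x => ?_
  set w : BochnerV T p V := indicatorConstLp _ hs hμs.ne x with hw
  have htoH : P.toH w = indicatorConstLp 2 hs hμs.ne (P.emb x) := by
    refine Lp.ext ?_
    filter_upwards [P.coeFn_toH w, indicatorConstLp_coeFn (p := 2) (hs := hs) (hμs := hμs.ne)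
      (c := P.emb x), indicatorConstLp_coeFn (p := ENNReal.ofReal p) (hs := hs) (hμs := hμs.ne)
      (c := x)] with t h1 h2 h3
    rw [h1, h2, hw, h3]
    by_cases hm : t ∈ s <;> simp [hm]
  rw [← L2.inner_indicatorConstLp_eq_inner_setIntegral ℝ hs hμs.ne, ← htoH, real_inner_comm,
    ← toDual_apply, hg, zero_apply]

/-- The left translation does not increase the quadratic form of `𝓜`: the part of the
nonnegative integrand that is moved out of `(0, T)` is lost. -/
theorem inner_opM_leftShift_le (hnonneg : ∀ u : H, 0 ≤ inner ℝ (P.M u) u) (τ : ℝ)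
    (w : BochnerV T p V) :
    inner ℝ (P.opM (P.toH (leftShift T p V τ w))) (P.toH (leftShift T p V τ w)) ≤
      inner ℝ (P.opM (P.toH w)) (P.toH w) := by
  set φ : ℝ → ℝ := (Ioo 0 T).indicator fun t => inner ℝ (P.M (P.emb (w t))) (P.emb (w t)) with hφ
  have hae : ∀ v : BochnerV T p V,
      (fun t => inner ℝ (P.opM (P.toH v) t) (P.toH v t)) =ᵐ[timeMeasure T]
        fun t => inner ℝ (P.M (P.emb (v t))) (P.emb (v t)) := fun v => by
    have h : P.opM (P.toH v) =ᵐ[timeMeasure T] fun t => P.M (P.toH v t) := P.M.coeFn_compLpL _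
    filter_upwards [h, P.coeFn_toH v] with t h1 h2
    rw [h1, h2]
  have hφ0 : ∀ t, 0 ≤ φ t := fun t => indicator_nonneg (fun t _ => hnonneg _) t
  have hφi : Integrable φ volume :=
    (integrable_indicator_iff measurableSet_Ioo).2
      ((L2.integrable_inner (𝕜 := ℝ) (P.opM (P.toH w)) (P.toH w)).congr (hae w))
  rw [L2.inner_def, L2.inner_def, integral_congr_ae (hae w), integral_congr_ae (hae _)]
  calc ∫ t, inner ℝ (P.M (P.emb (leftShift T p V τ w t))) (P.emb (leftShift T p V τ w t))
          ∂(timeMeasure T) = ∫ t, φ (t + τ) ∂(timeMeasure T) := by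
        refine integral_congr_ae ?_
        filter_upwards [coeFn_leftShift τ w] with t ht
        rw [ht]
        by_cases hm : t + τ ∈ Ioo 0 T <;> simp [hφ, hm]
    _ ≤ ∫ t, φ (t + τ) :=
        setIntegral_le_integral (hφi.comp_add_right τ) (ae_of_all _ fun t => hφ0 _)
    _ = ∫ t, φ t := integral_add_right_eq_self φ τ
    _ = _ := integral_indicator measurableSet_Ioo

/-- The operator `d/dt 𝓜` is monotone: by the Cauchy-Schwarz inequality for the form of `𝓜`,
`(𝓜 w, w(· + τ)) ≤ (𝓜 w, w)` for every `τ`. -/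
theorem hasTimeDeriv_apply_nonneg (hnonneg : ∀ u : H, 0 ≤ inner ℝ (P.M u) u)
    (hsymm : ∀ u v : H, inner ℝ (P.M u) v = inner ℝ (P.M v) u) {w : BochnerV T p V}
    {z : BochnerVDual T p V} (hz : HasTimeDeriv (P.toDual (P.opM (P.toH w))) z) : 0 ≤ z w := by
  have hlim := ((ContinuousLinearMap.apply ℝ ℝ w).continuous.tendsto z).comp hz
  refine ge_of_tendsto hlim ?_
  filter_upwards [self_mem_nhdsWithin] with τ hτ
  have hle := P.inner_opM_leftShift_le hnonneg τ w
  have h2 := two_mul_inner_le_of_nonneg (M := P.opM) (inner_compLpL_self_nonneg hnonneg)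
    (fun u v => by
      rw [opM, inner_compLpL_of_adjoint (R := P.M) (fun u v => by rw [hsymm, real_inner_comm]),
        real_inner_comm])
    (P.toH w) (P.toH (leftShift T p V τ w))
  have h3 : 0 ≤ τ⁻¹ * (inner ℝ (P.opM (P.toH w)) (P.toH w) -
      inner ℝ (P.opM (P.toH w)) (P.toH (leftShift T p V τ w))) :=
    mul_nonneg (inv_nonneg.2 (mem_Ioi.1 hτ).le) (by linarith)
  exact h3

/-- The restriction of `d/dt 𝓜 + 𝓐 + f` to `L²(0, T; H)` is strongly monotone when the function `k`
of the `k`-monotone operator `𝓐` dominates the norm of `L²(0, T; H)`. -/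
theorem Graph.monotone {P : CauchyProblem T p V H} {k : BochnerV T p V → ℝ} (hP : P.IsProper k)
    {c : ℝ} (hk : ∀ w : BochnerV T p V, c * ‖P.toH w‖ ^ 2 ≤ k w) {u v g h : BochnerH T H}
    (hu : P.Graph u g) (hv : P.Graph v h) : c * ‖u - v‖ ^ 2 ≤ inner ℝ (g - h) (u - v) := by
  obtain ⟨w, rfl, z, hz, hzg⟩ := hu
  obtain ⟨w', rfl, z', hz', hzh⟩ := hv
  have hd := hz.sub hz'
  rw [← toDual_sub, ← map_sub, ← map_sub] at hd
  have h0 := P.hasTimeDeriv_apply_nonneg hP.M_monotone hP.M_symmetric hd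
  have h1 := (hk (w - w')).trans (hP.k_monotone w w')
  rw [← map_sub, ← toDual_apply, toDual_sub, ← hzg, ← hzh]
  simp only [sub_apply, add_apply] at h0 h1 ⊢
  linarith

/-- If `u` solves `𝓕 u = 0` in the dual of `L^p(0, T; V)`, then `0` is the only value in
`L²(0, T; H)` that the graph of `𝓕` assigns to `u`. -/
theorem IsSol.eq_zero_of_graph {P : CauchyProblem T p V H} {k : BochnerV T p V → ℝ}
    (hP : P.IsProper k) {u : BochnerV T p V} (hu : P.IsSol u 0) {g : BochnerH T H}
    (hg : P.Graph (P.toH u) g) : g = 0 := by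
  have := hP.complete_H
  obtain ⟨w, hw, z, hz, hzg⟩ := hg
  obtain ⟨z', hz', hz0⟩ := hu
  obtain rfl := P.toH_injective hP.emb_injective hw
  obtain rfl := hz.unique hz'
  exact P.toDual_eq_zero hP.emb_dense (hzg.symm.trans hz0)

end CauchyProblem

end TimeDerivative

/-! ### Monotonicity of the split operators -/

section Decomposition

variable {T p : ℝ} [Fact (2 ≤ p)] {q : ℕ} {V H : Type*}
  [NormedAddCommGroup V] [NormedSpace ℝ V]
  [NormedAddCommGroup H] [InnerProductSpace ℝ H]
  {Vl Hl : Fin q → Type*}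
  [∀ l, NormedAddCommGroup (Vl l)] [∀ l, NormedSpace ℝ (Vl l)]
  [∀ l, NormedAddCommGroup (Hl l)] [∀ l, InnerProductSpace ℝ (Hl l)]

theorem SubGraph.monotone {P : CauchyProblem T p V H} {Pl : ∀ l, CauchyProblem T p (Vl l) (Hl l)}
    {E : ∀ l, Hl l →L[ℝ] H} {R : ∀ l, H →L[ℝ] Hl l}
    {k : BochnerV T p V → ℝ} {kl : ∀ l, BochnerV T p (Vl l) → ℝ}
    (hdec : IsDecomposition P Pl E R k kl) {c : ℝ}
    (hk : ∀ l (w : BochnerV T p (Vl l)), c * ‖(Pl l).toH w‖ ^ 2 ≤ kl l w) {l : Fin q}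
    {u v g h : BochnerH T H} (hu : SubGraph Pl E R l u g) (hv : SubGraph Pl E R l v h) :
    c * ‖(R l).compLpL 2 (timeMeasure T) (u - v)‖ ^ 2 ≤ inner ℝ (g - h) (u - v) := by
  obtain ⟨g', hg, rfl⟩ := hu
  obtain ⟨h', hh, rfl⟩ := hv
  rw [← map_sub, inner_compLpL_of_adjoint (hdec.adjoint l), map_sub ((R l).compLpL _ _)]
  exact hg.monotone (hdec.proper_sub l) (hk l) hh

end Decomposition

/-! ### Convergence of the additive splitting scheme -/

theorem mainTheorem2 {T p : ℝ} (hT : 0 < T) [Fact (2 ≤ p)] {q : ℕ} {V H : Type*}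
    [NormedAddCommGroup V] [NormedSpace ℝ V]
    [NormedAddCommGroup H] [InnerProductSpace ℝ H]
    {Vl Hl : Fin q → Type*}
    [∀ l, NormedAddCommGroup (Vl l)] [∀ l, NormedSpace ℝ (Vl l)]
    [∀ l, NormedAddCommGroup (Hl l)] [∀ l, InnerProductSpace ℝ (Hl l)]
    (P : CauchyProblem T p V H) (Pl : ∀ l, CauchyProblem T p (Vl l) (Hl l))
    (E : ∀ l, Hl l →L[ℝ] H) (R : ∀ l, H →L[ℝ] Hl l)
    (k : BochnerV T p V → ℝ) (kl : ∀ l, BochnerV T p (Vl l) → ℝ)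
    (hdec : IsDecomposition P Pl E R k kl)
    (hspan : ∀ v : H, ∃ w : ∀ l, Hl l, v = ∑ l, E l (w l))
    (hcomp : IsSpaceCompatible P Pl R)
    (hsplit : IsOperatorSplitting P Pl E R)
    {c : ℝ} (hc : 0 < c)
    (hk : ∀ l (w : BochnerV T p (Vl l)), c * ‖(Pl l).toH w‖ ^ 2 ≤ kl l w)
    (u : BochnerV T p V) (hu : P.IsSol u 0)
    (hreg : ∀ l, ∃ g : BochnerH T H, SubGraph Pl E R l (P.toH u) g)
    {C : ℝ} (hC : 0 < C) (u₀ : BochnerH T H) (U : ℕ → ℕ → BochnerH T H)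
    (hU₀ : ∀ N, U N 0 = u₀)
    (hU : ∀ N : ℕ, IsAdditiveSplitting Pl E R (C * Real.sqrt N) N (U N)) :
    Tendsto (fun N : ℕ => ‖U N N - P.toH u‖) atTop (𝓝 0) := by
  have := hdec.proper.complete_H
  have := fun l => (hdec.proper_sub l).complete_H
  rcases Nat.eq_zero_or_pos q with rfl | hq
  · -- Without subspaces the spanning assumption forces `H = 0`.
    have hH : ∀ v : H, v = 0 := fun v => by
      obtain ⟨w, hw⟩ := hspan v
      simpa using hw
    have h0 : ∀ N, ‖U N N - P.toH u‖ = 0 := fun N => by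
      rw [norm_eq_zero, Lp.eq_zero_iff_ae_eq_zero]
      exact ae_of_all _ fun t => hH _
    simp [h0]
  obtain ⟨κ, hκ, hcoer⟩ := exists_pos_mul_norm_sq_le_sum hdec.adjoint hspan
  choose g hg using hreg
  have hg0 : ∑ l, g l = 0 := hu.eq_zero_of_graph hdec.proper (hsplit _ g hg)
  have hq' : (0 : ℝ) < q := by exact_mod_cast hq
  set δ := c * κ / q with hδ
  have hδ0 : 0 < δ := by positivity
  set K := 2 * (∑ l, ‖g l‖ ^ 2) / q with hK
  have hK0 : 0 ≤ K := by positivity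
  let S : ∀ l, BochnerH T H →L[ℝ] BochnerH T (Hl l) := fun l => (R l).compLpL 2 (timeMeasure T)
  have hs : Tendsto (fun N : ℕ => C * √(N : ℝ)) atTop atTop :=
    (Real.tendsto_sqrt_atTop.comp tendsto_natCast_atTop_atTop).const_mul_atTop hC
  have hbound : ∀ᶠ N : ℕ in atTop, ‖U N N - P.toH u‖ ^ 2 ≤
      (1 - δ / (C * √N)) ^ N * ‖u₀ - P.toH u‖ ^ 2 + K / δ / (C * √N) := by
    have hS : ∀ᶠ N : ℕ in atTop, ∀ l, 4 * c * ‖S l‖ ^ 2 ≤ C * √(N : ℝ) :=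
      eventually_all.2 fun l => hs.eventually_ge_atTop _
    -- The energy estimate needs `s` large relative to the norms of `𝓡 l`, and `1 - δ / s ≥ 0`.
    filter_upwards [hS, hs.eventually_ge_atTop δ] with N hSN hδN
    have hsN : 0 < C * √(N : ℝ) := hδ0.trans_le hδN
    rw [← hU₀ N]
    refine le_pow_mul_add_of_recursion (a := fun n => ‖U N n - P.toH u‖ ^ 2) hδ0 hδN hK0
      (fun n hn => ?_) N le_rfl
    obtain ⟨ul, hul, hmean⟩ := hU N n hn
    choose G hG hGeq using hul
    have hmean' : U N (n + 1) - P.toH u = (1 / (q : ℝ)) • ∑ l, (ul l - P.toH u) := by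
      rw [hmean, Finset.sum_sub_distrib, smul_sub, Finset.sum_const, Finset.card_univ,
        Fintype.card_fin, ← Nat.cast_smul_eq_nsmul ℝ, smul_smul, one_div,
        inv_mul_cancel₀ hq'.ne', one_smul]
    simp only [hmean']
    refine splitting_step_estimate (R := S) hq hc hsN hSN (mul_norm_sq_le_sum_compLpL hcoer) hg0
      (d := fun l => G l - g l) (fun l => ?_) fun l => (hG l).monotone hdec hk (hg l)
    rw [smul_sub, smul_sub, ← hGeq l]
    abel
  have hsq : Tendsto (fun N : ℕ => ‖U N N - P.toH u‖ ^ 2) atTop (𝓝 0) :=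
    tendsto_of_tendsto_of_tendsto_of_le_of_le' tendsto_const_nhds
      (tendsto_recursion_bound hδ0 hC _ _) (Eventually.of_forall fun N => by positivity) hbound
  simpa [Real.sqrt_sq] using hsq.sqrt
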